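/- **Setting.** Let $p$ be a binary-input discrete memoryless channel with input alphabet $\{0,1\}=\mathbb F_2$, finite output alphabet $\mathcal Y$ and transition probabilities $p(y|x)$. Block lengths are $n=2^m$, $m\ge 0$, and $[n]=\{1,\dots,n\}$. Let $G_n$ be the polar generator matrix over $\mathbb F_2$, $$G_1=I_1,\qquad G_n=(I_{n/2}\otimes F)\,R_n\,(I_2\otimes G_{n/2}),\qquad F=\begin{pmatrix}1&0\\1&1\end{pmatrix},$$ where $(s_1,\dots,s_n)R_n=(s_1,s_3,\dots,s_{n-1},s_2,s_4,\dots,s_n)$. Let $\mathbf W=(W_1,\dots,W_n)$ have independent equiprobable bits, and let $\mathbf Y=(Y_1,\dots,Y_n)$ be the output of $n$ independent uses of $p$ when the codeword $\mathbf X=\mathbf W G_n$ is transmitted. For $\mathcal A\subseteq[n]$ write $\mathbf W_{\mathcal A}=(W_j)_{j\in\mathcal A}$. Mutual information is measured in bits; put $$I_i=I(W_i;\mathbf W_{[i-1]},\mathbf Y),\qquad i\in[n].$$ The split channels and their Bhattacharyya parameters are $$p_n^{(i)}(\mathbf y,\mathbf u|x)=\frac1{2^{n-1}}\sum_{\mathbf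 c\in\{0,1\}^{n-i}}p\bigl(\mathbf y\,|\,(\mathbf u,x,\mathbf c)G_n\bigr),\qquad B(p_n^{(i)})=\sum_{\mathbf y\in\mathcal Y^n}\sum_{\mathbf u\in\{0,1\}^{i-1}}\sqrt{p_n^{(i)}(\mathbf y,\mathbf u|0)\,p_n^{(i)}(\mathbf y,\mathbf u|1)},$$ where $p(\mathbf y|\mathbf x)=\prod_{l=1}^n p(y_l|x_l)$. For subsets $\mathcal A'_n\subseteq\mathcal A_n\subseteq[n]$ and $\mathcal S_n\subseteq\mathcal A_n^{\rm c}=[n]\setminus\mathcal A_n$ put $\mathcal D_n=\mathcal A'_n\cup\mathcal S_n$, $\mathcal D_n^{\rm c}=[n]\setminus\mathcal D_n$, $\mathcal D_n^{(i)}=\{j\in\mathcal D_n: j<i\}$ and $$J_i=I\bigl(W_i;\mathbf W_{\mathcal D_n^{(i)}},\mathbf W_{\mathcal D_n^{\rm c}},\mathbf Y\bigr),\qquad i\in\mathcal D_n.$$ **Lemma.** 1. For every $n$ and all sets $\mathcal A_n,\mathcal A'_n,\mathcal S_n$ as above, $J_i\ge I_i$ for every $i\in\mathcal A'_n$. 2.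 Let $(\mathcal A_n)$, $n=2^m$, be a sequence of sets of good indices, meaning that at least one of the following holds: (a) the mutual informations $I_i$, $i\in\mathcal A_n$, tend to $1$ bit, that is, for every $\varepsilon>0$ and all sufficiently large $n$, $I_i>1-\varepsilon$ for all $i\in\mathcal A_n$; or (b) the Bhattacharyya parameters $B(p_n^{(i)})$, $i\in\mathcal A_n$, tend to $0$, that is, for every $\varepsilon>0$ and all sufficiently large $n$, $B(p_n^{(i)})<\varepsilon$ for all $i\in\mathcal A_n$. Fix $0<\delta<1$. Then for all sufficiently large $n$ (how large may depend only on $p$, on the sequence $(\mathcal A_n)$ and on $\delta$), all $\mathcal A'_n\subseteq\mathcal A_n$, all $\mathcal S_n\subseteq\mathcal A_n^{\rm c}$ and every $i\in\mathcal A'_n$, $$J_i\ge 1-\delta .$$ -/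

import Mathlib

open scoped BigOperators Matrix Kronecker

noncomputable section

/-- A binary-input discrete memoryless channel with finite output alphabet `Y`:
`prob x y` is the transition probability `p(y|x)`. -/
structure BinaryDMC (Y : Type*) [Fintype Y] where
  prob : ZMod 2 → Y → ℝ
  nonneg : ∀ x y, 0 ≤ prob x y
  sum_eq_one : ∀ x, ∑ y, prob x y = 1

/-! ### The polar generator matrix, for block length `n = 2 ^ m` -/

/-- The kernel `F = (1 0; 1 1)` over the binary field. -/
def polarKernel : Matrix (Fin 2) (Fin 2) (ZMod 2) := !![1, 0; 1, 1]

/-- Positions of a vector of length `2 ^ (m + 1)` as consecutive pairs: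
`(k, a)` is the (zero-based) position `2 * k + a`. -/
def pairIndex (m : ℕ) : Fin (2 ^ m) × Fin 2 ≃ Fin (2 ^ (m + 1)) :=
  finProdFinEquiv.trans (finCongr (pow_succ 2 m).symm)

/-- Positions of a vector of length `2 ^ (m + 1)` as two consecutive halves:
`(a, k)` is the (zero-based) position `2 ^ m * a + k`. -/
def halfIndex (m : ℕ) : Fin 2 × Fin (2 ^ m) ≃ Fin (2 ^ (m + 1)) :=
  finProdFinEquiv.trans (finCongr (pow_succ' 2 m).symm)

/-- The reverse shuffle operator: the row vector `s` is mapped to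
`s R = (s₁, s₃, …, s₂, s₄, …)`. -/
def reverseShuffle (m : ℕ) :
    Matrix (Fin (2 ^ (m + 1))) (Fin (2 ^ (m + 1))) (ZMod 2) :=
  Matrix.of fun i j => if ((pairIndex m).symm i).swap = (halfIndex m).symm j then 1 else 0

/-- The polar generator matrix `G_n` of size `n = 2 ^ m`:
`G_1 = I_1` and `G_n = (I_{n/2} ⊗ F) R_n (I_2 ⊗ G_{n/2})`. -/
def polarMatrix : (m : ℕ) → Matrix (Fin (2 ^ m)) (Fin (2 ^ m)) (ZMod 2)
  | 0 => 1
  | m + 1 =>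
      Matrix.reindex (pairIndex m) (pairIndex m)
          ((1 : Matrix (Fin (2 ^ m)) (Fin (2 ^ m)) (ZMod 2)) ⊗ₖ polarKernel)
        * reverseShuffle m
        * Matrix.reindex (halfIndex m) (halfIndex m)
          ((1 : Matrix (Fin 2) (Fin 2) (ZMod 2)) ⊗ₖ polarMatrix m)

namespace BinaryDMC

variable {Y : Type*} [Fintype Y]

/-- Block transition probability `p(y|x) = ∏ p(y_l|x_l)`. -/
def block (p : BinaryDMC Y) {n : ℕ} (x : Fin n → ZMod 2) (y : Fin n → Y) : ℝ :=
  ∏ l, p.prob (x l) (y l)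

/-- The combined channel `p_n(y|w) = p(y|w G_n)`, `n = 2 ^ m`. -/
def combined (p : BinaryDMC Y) (m : ℕ) (w : Fin (2 ^ m) → ZMod 2)
    (y : Fin (2 ^ m) → Y) : ℝ :=
  p.block (w ᵥ* polarMatrix m) y

open Classical in
/-- The split channel `p_n^{(l)}(y, u|x) = 2^{-(n-1)} ∑_c p_n(y|(u, x, c))`. The sum runs over the
vectors `v = (u, x, c)`, i.e. those that equal `u` before position `l` and `x` at position `l`. -/
def split (p : BinaryDMC Y) (m : ℕ) (l : Fin (2 ^ m)) (x : ZMod 2)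
    (y : Fin (2 ^ m) → Y) (u : Finset.Iio l → ZMod 2) : ℝ :=
  (1 / 2 ^ (2 ^ m - 1)) *
    ∑ v : Fin (2 ^ m) → ZMod 2,
      if (Finset.Iio l).restrict v = u ∧ v l = x then p.combined m v y else 0

/-- The Bhattacharyya parameter of the split channel `p_n^{(l)}`. -/
def bhattacharyya (p : BinaryDMC Y) (m : ℕ) (l : Fin (2 ^ m)) : ℝ :=
  ∑ y : Fin (2 ^ m) → Y, ∑ u : Finset.Iio l → ZMod 2,
    Real.sqrt (p.split m l 0 y u * p.split m l 1 y u)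

/-- The joint law of `(W, Y)`: the bits of `W` are independent and equiprobable, and `Y` is the
channel output when the codeword `W G_n` is transmitted. -/
def jointLaw (p : BinaryDMC Y) (m : ℕ) :
    (Fin (2 ^ m) → ZMod 2) × (Fin (2 ^ m) → Y) → ℝ :=
  fun ω => (1 / 2) ^ (2 ^ m) * p.combined m ω.1 ω.2

end BinaryDMC

open Classical in
/-- The law (probability mass function) of the random variable `f` on the finite probability space
with mass function `P`. -/
def lawOf {Ω α : Type*} [Fintype Ω] (P : Ω → ℝ) (f : Ω → α) (a : α) : ℝ :=
  ∑ ω, if f ω = a then P ω else 0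

/-- Mutual information `I(f; g)`, in bits, of two random variables on a finite probability space
with mass function `P`. Terms of joint probability zero contribute `0`. -/
def mutualInfo {Ω α β : Type*} [Fintype Ω] [Fintype α] [Fintype β]
    (P : Ω → ℝ) (f : Ω → α) (g : Ω → β) : ℝ :=
  ∑ a, ∑ b, lawOf P (fun ω => (f ω, g ω)) (a, b) *
    Real.logb 2 (lawOf P (fun ω => (f ω, g ω)) (a, b) / (lawOf P f a * lawOf P g b))

namespace BinaryDMC

variable {Y : Type*} [Fintype Y]

/-- `I_i = I(W_i; W_{[i-1]}, Y)`. -/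
def infoI (p : BinaryDMC Y) (m : ℕ) (i : Fin (2 ^ m)) : ℝ :=
  mutualInfo (p.jointLaw m) (fun ω => ω.1 i)
    (fun ω => ((Finset.Iio i).restrict ω.1, ω.2))

/-- `J_i = I(W_i; W_{D^{(i)}}, W_{Dᶜ}, Y)` with `D^{(i)} = {j ∈ D : j < i}`. -/
def infoJ (p : BinaryDMC Y) (m : ℕ) (D : Finset (Fin (2 ^ m))) (i : Fin (2 ^ m)) : ℝ :=
  mutualInfo (p.jointLaw m) (fun ω => ω.1 i)
    (fun ω => ((D.filter (· < i)).restrict ω.1, Dᶜ.restrict ω.1, ω.2))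

/-- The sets `A m ⊆ [2 ^ m]` consist of good indices in the sense of mutual information: the
quantities `I_i`, `i ∈ A m`, are arbitrarily close to one bit for large block lengths. -/
def InfoGood (p : BinaryDMC Y) (A : ∀ m : ℕ, Finset (Fin (2 ^ m))) : Prop :=
  ∀ ε : ℝ, 0 < ε → ∃ M : ℕ, ∀ m ≥ M, ∀ i ∈ A m, 1 - ε < p.infoI m i

/-- The sets `A m ⊆ [2 ^ m]` consist of good indices in the sense of the Bhattacharyya parameters:
those of the split channels with index in `A m` approach zero. -/
def BhattacharyyaGood (p : BinaryDMC Y) (A : ∀ m : ℕ, Finset (Fin (2 ^ m))) : Prop :=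
  ∀ ε : ℝ, 0 < ε → ∃ M : ℕ, ∀ m ≥ M, ∀ i ∈ A m, p.bhattacharyya m i < ε

end BinaryDMC

end

/-! Every index below `i` lies in `D` or in its complement, so the past of `W_i` is a function of
the observation defining `infoJ`. The data processing inequality `mutualInfo_comp_le` then gives
`infoI ≤ infoJ`, which is part 1 and settles part 2 in case (a). In case (b) it remains to see that
a small Bhattacharyya parameter `B` forces information near one bit. For an equiprobable bit, an
elementary bound on each term of the mutual information yields `1 - (2 / log 2) * B ≤ infoI`. The
structure of the polar matrix plays no role. -/

open Classical in
theorem sum_lawOf_mul {Ω α : Type*} [Fintype Ω] [Fintype α] (P : Ω → ℝ) (f : Ω → α)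
    (F : α → ℝ) : ∑ a, lawOf P f a * F a = ∑ ω, P ω * F (f ω) := by
  simp only [lawOf, Finset.sum_mul, ite_mul, zero_mul]
  rw [Finset.sum_comm]
  simp

theorem sum_lawOf {Ω α : Type*} [Fintype Ω] [Fintype α] (P : Ω → ℝ) (f : Ω → α) :
    ∑ a, lawOf P f a = ∑ ω, P ω := by
  simpa using sum_lawOf_mul P f (fun _ => 1)

open Classical in
theorem lawOf_nonneg {Ω α : Type*} [Fintype Ω] {P : Ω → ℝ} (hP : ∀ ω, 0 ≤ P ω) (f : Ω → α)
    (a : α) : 0 ≤ lawOf P f a :=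
  Finset.sum_nonneg fun ω _ => by split_ifs <;> simp [hP]

open Classical in
theorem lawOf_apply_pos {Ω α : Type*} [Fintype Ω] {P : Ω → ℝ} (hP : ∀ ω, 0 ≤ P ω) (f : Ω → α)
    {ω : Ω} (h : 0 < P ω) : 0 < lawOf P f (f ω) := by
  refine lt_of_lt_of_le h ?_
  have := Finset.single_le_sum (f := fun ω' => if f ω' = f ω then P ω' else 0)
    (fun ω' _ => by split_ifs <;> simp [hP]) (Finset.mem_univ ω)
  simpa [lawOf] using this

open Classical in
/-- The second marginal of a joint law. -/
theorem sum_lawOf_prodMk {Ω α β : Type*} [Fintype Ω] [Fintype α] (P : Ω → ℝ) (f : Ω → α)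
    (g : Ω → β) (b : β) : ∑ a, lawOf P (fun ω => (f ω, g ω)) (a, b) = lawOf P g b := by
  simp only [lawOf]
  rw [Finset.sum_comm]
  refine Finset.sum_congr rfl fun ω _ => ?_
  by_cases h : g ω = b <;> simp [h]

theorem mutualInfo_eq_sum {Ω α β : Type*} [Fintype Ω] [Fintype α] [Fintype β]
    (P : Ω → ℝ) (f : Ω → α) (g : Ω → β) :
    mutualInfo P f g = ∑ ω, P ω * Real.logb 2 (lawOf P (fun ω => (f ω, g ω)) (f ω, g ω) /
      (lawOf P f (f ω) * lawOf P g (g ω))) := by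
  rw [mutualInfo, ← Fintype.sum_prod_type']
  exact sum_lawOf_mul P (fun ω => (f ω, g ω))
    (fun x => Real.logb 2 (lawOf P (fun ω => (f ω, g ω)) x / (lawOf P f x.1 * lawOf P g x.2)))

/-- Data processing inequality. -/
theorem mutualInfo_comp_le {Ω α β γ : Type*} [Fintype Ω] [Fintype α] [Fintype β] [Fintype γ]
    {P : Ω → ℝ} (hP : ∀ ω, 0 ≤ P ω) (f : Ω → α) (g : Ω → β) (k : β → γ) :
    mutualInfo P f (fun ω => k (g ω)) ≤ mutualInfo P f g := by
  rw [mutualInfo_eq_sum, mutualInfo_eq_sum]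
  set q := lawOf P (fun ω => (f ω, g ω)) with hq
  set r := lawOf P (fun ω => (f ω, k (g ω))) with hr
  set qf := lawOf P f with hqf
  set qg := lawOf P g with hqg
  set rk := lawOf P (fun ω => k (g ω)) with hrk
  have hlog2 : 0 < Real.log 2 := Real.log_pos one_lt_two
  -- The two information densities differ by `-log₂ T`. Since `log T ≤ T - 1`, it suffices that `T`
  -- has mean at most the total mass; pairs with `q = 0` only lower that mean.
  let T : α × β → ℝ := fun x => qg x.2 * r (x.1, k x.2) / (q x * rk (k x.2))
  have hT : ∑ ω, P ω * T (f ω, g ω) ≤ ∑ ω, P ω := by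
    rw [← sum_lawOf_mul P (fun ω => (f ω, g ω)) T, ← sum_lawOf P g, Fintype.sum_prod_type_right]
    refine Finset.sum_le_sum fun b _ => ?_
    have hg0 : 0 ≤ qg b := lawOf_nonneg hP g b
    have hr0 : ∀ a, 0 ≤ r (a, k b) := fun a => lawOf_nonneg hP _ _
    have hk0 : 0 ≤ rk (k b) := lawOf_nonneg hP _ _
    calc ∑ a, q (a, b) * T (a, b) ≤ ∑ a, qg b / rk (k b) * r (a, k b) := by
          refine Finset.sum_le_sum fun a _ => ?_
          have hq0 : 0 ≤ q (a, b) := lawOf_nonneg hP _ _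
          rcases hq0.eq_or_lt with h | h
          · rw [← h, zero_mul]
            have := hr0 a
            positivity
          · apply le_of_eq
            simp only [T]
            rw [mul_div_assoc', mul_div_mul_left _ _ h.ne']
            ring
      _ = qg b / rk (k b) * rk (k b) := by
          rw [← Finset.mul_sum, hr, sum_lawOf_prodMk P f (fun ω => k (g ω)) (k b)]
      -- Only an inequality: if `rk (k b) = 0`, the quotient is `0` by convention.
      _ ≤ qg b := by
          rw [div_mul_eq_mul_div]
          exact div_le_of_le_mul₀ hk0 hg0 le_rfl
  have key : ∀ ω, P ω * Real.logb 2 (r (f ω, k (g ω)) / (qf (f ω) * rk (k (g ω)))) +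
      (P ω - P ω * T (f ω, g ω)) / Real.log 2 ≤
      P ω * Real.logb 2 (q (f ω, g ω) / (qf (f ω) * qg (g ω))) := by
    intro ω
    rcases (hP ω).eq_or_lt with h | h
    · simp [← h]
    have h1 : 0 < q (f ω, g ω) := lawOf_apply_pos hP (fun ω => (f ω, g ω)) h
    have h2 : 0 < r (f ω, k (g ω)) := lawOf_apply_pos hP (fun ω => (f ω, k (g ω))) h
    have h3 : 0 < qf (f ω) := lawOf_apply_pos hP f h
    have h4 : 0 < qg (g ω) := lawOf_apply_pos hP g h
    have h5 : 0 < rk (k (g ω)) := lawOf_apply_pos hP (fun ω => k (g ω)) h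
    have hTpos : 0 < T (f ω, g ω) := by simp only [T]; positivity
    have hl := Real.log_le_sub_one_of_pos hTpos
    have hTl : Real.log (T (f ω, g ω)) = Real.log (qg (g ω)) + Real.log (r (f ω, k (g ω))) -
        (Real.log (q (f ω, g ω)) + Real.log (rk (k (g ω)))) := by
      simp only [T]
      rw [Real.log_div (by positivity) (by positivity), Real.log_mul h4.ne' h2.ne',
        Real.log_mul h1.ne' h5.ne']
    rw [Real.logb, Real.logb, ← mul_div_assoc (P ω) (Real.log _), ← mul_div_assoc (P ω) (Real.log _),
      ← add_div,
      Real.log_div h2.ne' (by positivity), Real.log_div h1.ne' (by positivity),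
      Real.log_mul h3.ne' h5.ne', Real.log_mul h3.ne' h4.ne']
    refine div_le_div_of_nonneg_right ?_ hlog2.le
    have := mul_le_mul_of_nonneg_left hl h.le
    rw [hTl] at this
    linarith
  have hsum := Finset.sum_le_sum fun ω (_ : ω ∈ Finset.univ) => key ω
  rw [Finset.sum_add_distrib, ← Finset.sum_div, Finset.sum_sub_distrib] at hsum
  have : 0 ≤ (∑ ω, P ω - ∑ ω, P ω * T (f ω, g ω)) / Real.log 2 :=
    div_nonneg (sub_nonneg.2 hT) hlog2.le
  linarith

/-- The logarithm equals `1 - log₂ (1 + z / x)`, and `log (1 + t) ≤ 2 log (1 + √t) ≤ 2√t`; finally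
`x √(z / x) = √(x z)`. -/
theorem le_mul_logb_div_half_add {x z : ℝ} (hx : 0 ≤ x) (hz : 0 ≤ z) :
    x - 2 / Real.log 2 * √(x * z) ≤ x * Real.logb 2 (x / (1 / 2 * (x + z))) := by
  rcases hx.eq_or_lt with rfl | hx
  · simp
  have hlog2 : 0 < Real.log 2 := Real.log_pos one_lt_two
  have hs : √(x * z) = x * √(z / x) := by
    rw [show x * z = x ^ 2 * (z / x) by field_simp, Real.sqrt_mul (sq_nonneg x),
      Real.sqrt_sq hx.le]
  have hlog : Real.log (1 + z / x) ≤ 2 * √(z / x) := by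
    have h0 : 0 ≤ √(z / x) := Real.sqrt_nonneg _
    have h1 : Real.log (1 + z / x) ≤ Real.log ((1 + √(z / x)) ^ 2) := by
      apply Real.log_le_log (by positivity)
      nlinarith [Real.sq_sqrt (show 0 ≤ z / x by positivity)]
    have h2 := Real.log_le_sub_one_of_pos (show 0 < 1 + √(z / x) by positivity)
    rw [Real.log_pow] at h1
    push_cast at h1
    linarith
  have hr : Real.log (x / (1 / 2 * (x + z))) = Real.log 2 - Real.log (1 + z / x) := by
    rw [← Real.log_div two_ne_zero (by positivity)]
    congr 1
    field_simp
  rw [Real.logb, hr, hs, mul_div_assoc', le_div_iff₀ hlog2, sub_mul,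
    show 2 / Real.log 2 * (x * √(z / x)) * Real.log 2 = 2 * (x * √(z / x)) by field_simp]
  nlinarith

/-- Mutual information of an equiprobable bit `f` with `g`, bounded by a Bhattacharyya sum. -/
theorem le_mutualInfo_of_equiprobable {Ω β : Type*} [Fintype Ω] [Fintype β]
    {P : Ω → ℝ} (hP : ∀ ω, 0 ≤ P ω) {f : Ω → ZMod 2} (hf : ∀ a, lawOf P f a = 1 / 2)
    (g : Ω → β) :
    1 - 4 / Real.log 2 * ∑ b, √(lawOf P (fun ω => (f ω, g ω)) (0, b) *
      lawOf P (fun ω => (f ω, g ω)) (1, b)) ≤ mutualInfo P f g := by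
  set q := lawOf P (fun ω => (f ω, g ω)) with hq
  have hq0 : ∀ x, 0 ≤ q x := lawOf_nonneg hP _
  have htwo : ∀ F : ZMod 2 → ℝ, ∑ a, F a = F 0 + F 1 := fun F => Fin.sum_univ_two F
  have hmarg : ∀ b, lawOf P g b = q (0, b) + q (1, b) := fun b => by
    rw [← sum_lawOf_prodMk P f g b, htwo]
  have hone : ∑ b, lawOf P g b = 1 := by
    rw [sum_lawOf, ← sum_lawOf P f, htwo, hf, hf]; norm_num
  rw [mutualInfo, Finset.sum_comm, ← hone, Finset.mul_sum, ← Finset.sum_sub_distrib]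
  refine Finset.sum_le_sum fun b _ => ?_
  rw [htwo, hf, hf, hmarg]
  -- Each of the two bit values loses `2 / log 2` times the same square root, whence the constant `4
  -- / log 2`.
  have h0 := le_mul_logb_div_half_add (hq0 (0, b)) (hq0 (1, b))
  have h1 := le_mul_logb_div_half_add (hq0 (1, b)) (hq0 (0, b))
  rw [mul_comm (q (1, b)) (q (0, b)), add_comm (q (1, b)) (q (0, b))] at h1
  have h4 : 4 / Real.log 2 = 2 / Real.log 2 + 2 / Real.log 2 := by ring
  rw [h4]
  linarith

namespace BinaryDMC

variable {Y : Type*} [Fintype Y]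

theorem block_nonneg (p : BinaryDMC Y) {n : ℕ} (x : Fin n → ZMod 2) (y : Fin n → Y) :
    0 ≤ p.block x y :=
  Finset.prod_nonneg fun _ _ => p.nonneg _ _

open Classical in
theorem sum_block (p : BinaryDMC Y) {n : ℕ} (x : Fin n → ZMod 2) : ∑ y, p.block x y = 1 := by
  simp only [block]
  rw [← Fintype.prod_sum fun l y => p.prob (x l) y]
  simp [p.sum_eq_one]

theorem jointLaw_nonneg (p : BinaryDMC Y) (m : ℕ) (ω) : 0 ≤ p.jointLaw m ω :=
  mul_nonneg (by positivity) (p.block_nonneg _ _)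

open Classical in
/-- The law of each input bit is uniform. -/
theorem lawOf_jointLaw_apply (p : BinaryDMC Y) (m : ℕ) (i : Fin (2 ^ m)) (a : ZMod 2) :
    lawOf (p.jointLaw m) (fun ω => ω.1 i) a = 1 / 2 := by
  have h : ∀ a, lawOf (p.jointLaw m) (fun ω => ω.1 i) a =
      ∑ v : Fin (2 ^ m) → ZMod 2, if v i = a then (1 / 2 : ℝ) ^ (2 ^ m) else 0 := by
    intro a
    rw [lawOf, Fintype.sum_prod_type]
    refine Finset.sum_congr rfl fun v _ => ?_
    by_cases hv : v i = a
    · simp only [hv, if_true, jointLaw, combined]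
      rw [← Finset.mul_sum, sum_block, mul_one]
    · simp [hv]
  -- Flipping bit `i` permutes the input words, so both bit values have equal mass.
  have hshift : ∀ a, lawOf (p.jointLaw m) (fun ω => ω.1 i) (a + 1) =
      lawOf (p.jointLaw m) (fun ω => ω.1 i) a := by
    intro a
    rw [h, h, ← Equiv.sum_comp (Equiv.addRight (Pi.single i (1 : ZMod 2)))]
    simp
  have htot : ∑ a, lawOf (p.jointLaw m) (fun ω => ω.1 i) a = 1 := by
    simp only [h]
    rw [Finset.sum_comm]
    simp [ZMod.card]
  have htwo : ∑ a, lawOf (p.jointLaw m) (fun ω => ω.1 i) a =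
      lawOf (p.jointLaw m) (fun ω => ω.1 i) 0 + lawOf (p.jointLaw m) (fun ω => ω.1 i) 1 :=
    Fin.sum_univ_two _
  have h01 := hshift 0
  rw [zero_add] at h01
  have ha : a = 0 ∨ a = 1 := by revert a; decide
  rcases ha with rfl | rfl <;> linarith

-- The factor `1 / 2` is the prior of `W_i`; in the Bhattacharyya sum it turns `4 / log 2` into `2 /
-- log 2`.
open Classical in
theorem lawOf_jointLaw_eq_split (p : BinaryDMC Y) (m : ℕ) (i : Fin (2 ^ m)) (x : ZMod 2)
    (u : Finset.Iio i → ZMod 2) (y : Fin (2 ^ m) → Y) :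
    lawOf (p.jointLaw m) (fun ω => (ω.1 i, ((Finset.Iio i).restrict ω.1, ω.2))) (x, (u, y)) =
      1 / 2 * p.split m i x y u := by
  have hpow : (1 / 2 : ℝ) ^ (2 ^ m) = 1 / 2 * (1 / 2 ^ (2 ^ m - 1)) := by
    obtain ⟨k, hk⟩ : ∃ k, 2 ^ m = k + 1 := Nat.exists_eq_succ_of_ne_zero (by positivity)
    rw [hk, Nat.add_sub_cancel, pow_succ, one_div_pow, mul_comm]
  rw [lawOf, Fintype.sum_prod_type, split, ← mul_assoc, ← hpow, Finset.mul_sum]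
  refine Finset.sum_congr rfl fun v _ => ?_
  by_cases h : (Finset.Iio i).restrict v = u ∧ v i = x
  · simp [h, jointLaw]
  · rw [if_neg h, mul_zero]
    refine Finset.sum_eq_zero fun y' _ => if_neg fun he => h ?_
    simp only [Prod.mk.injEq] at he
    exact ⟨he.2.1, he.1⟩

theorem one_sub_bhattacharyya_le_infoI (p : BinaryDMC Y) (m : ℕ) (i : Fin (2 ^ m)) :
    1 - 2 / Real.log 2 * p.bhattacharyya m i ≤ p.infoI m i := by
  refine le_trans (le_of_eq ?_) (le_mutualInfo_of_equiprobable (p.jointLaw_nonneg m)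
    (p.lawOf_jointLaw_apply m i) (fun ω => ((Finset.Iio i).restrict ω.1, ω.2)))
  have hs : ∀ s t : ℝ, √(1 / 2 * s * (1 / 2 * t)) = 1 / 2 * √(s * t) := fun s t => by
    rw [show 1 / 2 * s * (1 / 2 * t) = (1 / 2) ^ 2 * (s * t) by ring,
      Real.sqrt_mul (by positivity), Real.sqrt_sq (by norm_num)]
  rw [Fintype.sum_prod_type_right]
  simp only [lawOf_jointLaw_eq_split, hs, ← Finset.mul_sum]
  rw [bhattacharyya]
  ring

theorem infoI_le_infoJ (p : BinaryDMC Y) (m : ℕ) (D : Finset (Fin (2 ^ m))) (i : Fin (2 ^ m)) :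
    p.infoI m i ≤ p.infoJ m D i := by
  -- `k` reassembles the past of `i`, reading each bit from whichever of the two blocks contains it.
  let k : ((D.filter (· < i) → ZMod 2) × ((Dᶜ : Finset (Fin (2 ^ m))) → ZMod 2) ×
      (Fin (2 ^ m) → Y)) → (Finset.Iio i → ZMod 2) × (Fin (2 ^ m) → Y) := fun z =>
    (fun j => if h : j.1 ∈ D
      then z.1 ⟨j.1, Finset.mem_filter.2 ⟨h, Finset.mem_Iio.1 j.2⟩⟩
      else z.2.1 ⟨j.1, Finset.mem_compl.2 h⟩, z.2.2)
  have hk : (fun ω : (Fin (2 ^ m) → ZMod 2) × (Fin (2 ^ m) → Y) =>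
      ((Finset.Iio i).restrict ω.1, ω.2)) =
      fun ω => k ((D.filter (· < i)).restrict ω.1, Dᶜ.restrict ω.1, ω.2) := by
    funext ω
    refine Prod.ext (funext fun j => ?_) rfl
    by_cases h : j.1 ∈ D <;> simp [k, h]
  rw [infoI, infoJ, hk]
  exact mutualInfo_comp_le (p.jointLaw_nonneg m) _ _ k

end BinaryDMC

theorem mainTheorem6 {Y : Type*} [Fintype Y] (p : BinaryDMC Y) :
    (∀ (m : ℕ) (A A' S : Finset (Fin (2 ^ m))), A' ⊆ A → S ⊆ Aᶜ →
      ∀ i ∈ A', p.infoI m i ≤ p.infoJ m (A' ∪ S) i) ∧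
    (∀ A : ∀ m : ℕ, Finset (Fin (2 ^ m)), p.InfoGood A ∨ p.BhattacharyyaGood A →
      ∀ δ : ℝ, 0 < δ → δ < 1 →
        ∃ M : ℕ, ∀ m ≥ M, ∀ A' S : Finset (Fin (2 ^ m)), A' ⊆ A m → S ⊆ (A m)ᶜ →
          ∀ i ∈ A', 1 - δ ≤ p.infoJ m (A' ∪ S) i) := by
  refine ⟨fun m A A' S _ _ i _ => p.infoI_le_infoJ m _ i, fun A hA δ hδ _ => ?_⟩
  rcases hA with hA | hA
  · obtain ⟨M, hM⟩ := hA δ hδ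
    exact ⟨M, fun m hm A' S hA' _ i hi =>
      (hM m hm i (hA' hi)).le.trans (p.infoI_le_infoJ m _ i)⟩
  · have hlog2 : 0 < Real.log 2 := Real.log_pos one_lt_two
    -- Chosen so that the loss `(2 / log 2) * B` is at most `δ`.
    obtain ⟨M, hM⟩ := hA (δ * Real.log 2 / 2) (by positivity)
    refine ⟨M, fun m hm A' S hA' _ i hi => ?_⟩
    refine le_trans ?_ ((p.one_sub_bhattacharyya_le_infoI m i).trans (p.infoI_le_infoJ m _ i))
    have h := mul_le_mul_of_nonneg_left (hM m hm i (hA' hi)).le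
      (show 0 ≤ 2 / Real.log 2 by positivity)
    rw [show 2 / Real.log 2 * (δ * Real.log 2 / 2) = δ by field_simp] at h
    linarith
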